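/- Let $r = 4^4/5^5$ and let $(s,c)$ be the holomorphic solution pair, in the open disc $B_r(0)\subset\mathbb{C}$, of the initial value problem $$s' = c^5,\quad c' = -s^5;\qquad s(0)=0,\quad c(0)=1,$$ which exists. Put $\delta = e^{i\pi/6}$, $\gamma = e^{i\pi/3}$, $$L = \int_0^1 \frac{d\xi}{(1-\xi^6)^{1/3}}, \qquad K = \int_0^1 \frac{d\xi}{(1+\xi^6)^{1/3}}.$$ Let $\mathbb{H}$ be the open regular hexagon with vertices $L\gamma^k$ $(0\le k\le 5)$, and for $n\in\mathbb{Z}$ let $\mathbb{H}_n = 2nK+\delta\,\mathbb{H}$. Then $K = \tfrac12\sqrt3\,L$, so $\mathbb{H}_n$ and $\mathbb{H}_{n+1}$ share a vertical edge, with endpoints $2nK+\delta L$ and $2nK+\overline{\delta}L$. Let $\mathcal{H}$ be the union of all the open hexagons $\mathbb{H}_n$ together with these shared open edges. Then $B_r(0)\subset\mathcal{H}$, $c$ has no zero in $B_r(0)$, and the quotient $t=s/c$ extends to a function that is meromorphic in $\mathcal{H}$. This extension has period $4K$, which is its least positive real period, and it is holomorphic in $\mathcal{H}$ except for simple poles at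 the odd multiples of $2K$. -/

import Mathlib

noncomputable section

namespace HexBand

/-- The radius `4 ^ 4 / 5 ^ 5` of the disc on which the initial value problem is solved. -/
def r : ℝ := 4 ^ 4 / 5 ^ 5

/-- `(s, c)` is a holomorphic solution pair, in the open disc of radius `r` about `0`, of
`s' = c ^ 5`, `c' = -s ^ 5`, `s 0 = 0`, `c 0 = 1`. -/
structure IsSolutionPair (s c : ℂ → ℂ) : Prop where
  deriv_s : ∀ z ∈ Metric.ball (0 : ℂ) r, HasDerivAt s (c z ^ 5) z
  deriv_c : ∀ z ∈ Metric.ball (0 : ℂ) r, HasDerivAt c (-(s z ^ 5)) z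
  s_zero : s 0 = 0
  c_zero : c 0 = 1

/-- The primitive sixth root of unity `e ^ (i π / 3)`. -/
def γ : ℂ := Complex.exp (Complex.I * (Real.pi / 3))

/-- The number `e ^ (i π / 6)`. -/
def δ : ℂ := Complex.exp (Complex.I * (Real.pi / 6))

/-- The circumradius (and side) of the hexagons. -/
def L : ℝ := ∫ ξ in (0 : ℝ)..1, 1 / (1 - ξ ^ 6) ^ (1 / 3 : ℝ)

/-- Half of the translation step. -/
def K : ℝ := ∫ ξ in (0 : ℝ)..1, 1 / (1 + ξ ^ 6) ^ (1 / 3 : ℝ)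

/-- The open regular hexagon with centre `0` and vertices `L * γ ^ k`. -/
def hexagon : Set ℂ :=
  interior (convexHull ℝ (Set.range fun k : Fin 6 => (L : ℂ) * γ ^ (k : ℕ)))

/-- The open hexagon `2 n K + δ • hexagon`; it has two vertical sides. -/
def hexagonAt (n : ℤ) : Set ℂ :=
  (fun z : ℂ => 2 * (n : ℂ) * (K : ℂ) + δ * z) '' hexagon

/-- The open right-hand vertical edge of `hexagonAt n`, which it shares with
`hexagonAt (n + 1)`. -/
def sharedEdge (n : ℤ) : Set ℂ :=
  openSegment ℝ (2 * (n : ℂ) * (K : ℂ) + δ * (L : ℂ))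
    (2 * (n : ℂ) * (K : ℂ) + (starRingEnd ℂ) δ * (L : ℂ))

/-- The row of hexagons: all the open hexagons `hexagonAt n` together with the open edges
that adjacent ones share. -/
def band : Set ℂ := (⋃ n : ℤ, hexagonAt n) ∪ ⋃ n : ℤ, sharedEdge n

/-- The odd multiples of `2 K`. -/
def oddPoints : Set ℂ := {z | ∃ k : ℤ, z = (2 * (k : ℂ) + 1) * (2 * (K : ℂ))}

end HexBand

end

namespace HexBand

open Set Filter Topology MeasureTheory Complex
open scoped Interval ComplexConjugate

/-! Along a solution `s ^ 6 + c ^ 6 = 1`, so `t = s / c` satisfies `t' = 1 / c ^ 2 = (1 + t ^ 6) ^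
(1 / 3)` with `t 0 = 0`. Hence `t` inverts the Schwarz-Christoffel integral `scMap` of `(1 + w ^ 6)
^ (-1 / 3)`, which maps the unit disc conformally onto `δ * hexagon`.

Injectivity on the closed disc holds because the derivative has positive real part inside
(`injOn_scMap`). The image is found topologically (`image_hexagon`): the circle goes into the six
lines carrying the sides (`re_scMap_circle`), the image of the open disc is open, that of the closed
disc is compact, and each sector of the disc goes into a triangle.

Continuation across a vertical edge is Schwarz reflection, in the form `scMap w + scMap w⁻¹ = 2 * K`
near the arc through `1` (`scMap_exp_add_scMap_exp_neg`). As `scMap` is odd, this says `t (z + 2 *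
K) = -1 / t z`. So `hexTan` is defined by this rule from the inverse on one hexagon; its period is
`4 * K`, and the simple zero at `0` becomes a simple pole at each odd multiple of `2 * K`. Finally
`c = (1 + t ^ 6) ^ (-1 / 6)` and `s = t * c` solve the initial value problem, and uniqueness
identifies them with any given pair. -/

/-! ### The Schwarz-Christoffel integral and its derivative. -/

/-- The Schwarz-Christoffel density of the hexagon. -/
noncomputable def density (w : ℂ) : ℂ := (1 + w ^ 6) ^ (-(1 / 3) : ℂ)

/-- The Schwarz-Christoffel map from the unit disc onto the hexagon `δ * hexagon`. -/
noncomputable def scMap (w : ℂ) : ℂ := ∫ x in (0 : ℝ)..1, w * density (x * w)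

/-- The plane slit along six rays, on which `density` is holomorphic. -/
def slitDomain : Set ℂ := {w | 1 + w ^ 6 ∈ slitPlane}

lemma isOpen_slitDomain : IsOpen slitDomain :=
  isOpen_slitPlane.preimage (by fun_prop)

/-- `1 + (x * w) ^ 6` is a convex combination of `1` and `1 + w ^ 6`, and the slit plane is
star-shaped about `1`. -/
lemma ofReal_mul_mem_slitDomain {w : ℂ} (hw : w ∈ slitDomain) {x : ℝ} (h0 : 0 ≤ x) (h1 : x ≤ 1) :
    (x : ℂ) * w ∈ slitDomain := by
  have h := starConvex_one_slitPlane (show 1 + w ^ 6 ∈ slitPlane from hw)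
    (show 0 ≤ 1 - x ^ 6 by have := pow_le_one₀ h0 h1 (n := 6); linarith)
    (show 0 ≤ x ^ 6 by positivity) (by ring)
  have e : (1 - x ^ 6) • (1 : ℂ) + x ^ 6 • (1 + w ^ 6) = 1 + ((x : ℂ) * w) ^ 6 := by
    simp only [real_smul]; push_cast; ring
  rw [e] at h
  exact h

lemma re_one_add_pow_pos {w : ℂ} (hw : ‖w‖ < 1) : 0 < (1 + w ^ 6).re := by
  have h1 : ‖w ^ 6‖ < 1 := by
    rw [norm_pow]; exact pow_lt_one₀ (norm_nonneg _) hw (by norm_num)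
  have h2 := (abs_le.1 (abs_re_le_norm (w ^ 6))).1
  simp only [add_re, one_re]; linarith

lemma mem_slitDomain_of_norm_lt_one {w : ℂ} (hw : ‖w‖ < 1) : w ∈ slitDomain :=
  Or.inl (re_one_add_pow_pos hw)

lemma density_ne_zero {w : ℂ} (hw : w ∈ slitDomain) : density w ≠ 0 := by
  rw [density, Ne, cpow_eq_zero_iff]
  exact fun h => slitPlane_ne_zero hw h.1

/-- The derivative of `density`. -/
noncomputable def densityDeriv (w : ℂ) : ℂ :=
  -(1 / 3) * (1 + w ^ 6) ^ (-(1 / 3) - 1 : ℂ) * (6 * w ^ 5)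

lemma hasDerivAt_density {w : ℂ} (hw : w ∈ slitDomain) :
    HasDerivAt density (densityDeriv w) w := by
  have h : HasDerivAt (fun w : ℂ => 1 + w ^ 6) (6 * w ^ 5) w := by
    simpa using (hasDerivAt_pow 6 w).const_add 1
  exact h.cpow_const hw

lemma continuousOn_density : ContinuousOn density slitDomain :=
  fun _ hw => (hasDerivAt_density hw).continuousAt.continuousWithinAt

lemma continuousOn_densityDeriv : ContinuousOn densityDeriv slitDomain := by
  intro v hv
  have h1 : HasDerivAt (fun w : ℂ => 1 + w ^ 6) (6 * v ^ 5) v := by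
    simpa using (hasDerivAt_pow 6 v).const_add 1
  have h2 : ContinuousAt (fun w : ℂ => (1 + w ^ 6) ^ (-(1 / 3) - 1 : ℂ)) v :=
    (h1.cpow_const hv).continuousAt
  exact ((continuousAt_const.mul h2).mul (by fun_prop)).continuousWithinAt

lemma hasDerivAt_density_mul {x w : ℂ} (h : x * w ∈ slitDomain) :
    HasDerivAt (fun v => density (x * v)) (densityDeriv (x * w) * x) w := by
  have h1 : HasDerivAt (fun v : ℂ => x * v) x w := by
    simpa using (hasDerivAt_id w).const_mul x
  exact (hasDerivAt_density h).comp w h1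

lemma hasDerivAt_scMap {w : ℂ} (hw : w ∈ slitDomain) : HasDerivAt scMap (density w) w := by
  set C : Set ℂ := (fun x : ℝ => (x : ℂ) * w) '' Icc 0 1 with hC
  have hCc : IsCompact C := isCompact_Icc.image (by fun_prop)
  have hCs : C ⊆ slitDomain := by
    rintro _ ⟨x, hx, rfl⟩; exact ofReal_mul_mem_slitDomain hw hx.1 hx.2
  -- A compact neighbourhood of the segment from `0` to `w` gives uniform bounds for differentiating
  -- under the integral.
  obtain ⟨ε, hε, hsub⟩ := hCc.exists_cthickening_subset_open isOpen_slitDomain hCs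
  have hEc : IsCompact (Metric.cthickening ε C) := hCc.cthickening
  have hmem : ∀ x ∈ Icc (0 : ℝ) 1, ∀ v ∈ Metric.ball w ε, (x : ℂ) * v ∈ Metric.cthickening ε C := by
    intro x hx v hv
    refine Metric.mem_cthickening_of_dist_le _ (x * w) _ _ ⟨x, hx, rfl⟩ ?_
    rw [dist_eq, ← mul_sub, norm_mul, norm_real, Real.norm_of_nonneg hx.1]
    have := (mem_ball_iff_norm.1 hv).le
    nlinarith [norm_nonneg (v - w), hx.2, hx.1]
  obtain ⟨A, hA⟩ := hEc.exists_bound_of_continuousOn (continuousOn_density.mono hsub)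
  obtain ⟨B, hB⟩ := hEc.exists_bound_of_continuousOn (continuousOn_densityDeriv.mono hsub)
  have hcomp : ∀ v ∈ Metric.ball w ε, ∀ f : ℂ → ℂ, ContinuousOn f slitDomain →
      ContinuousOn (fun x : ℝ => f (x * v)) (Icc 0 1) := by
    intro v hv f hf
    exact hf.comp (by fun_prop) fun x hx => hsub (hmem x hx v hv)
  have hwb := Metric.mem_ball_self (x := w) hε
  have hI : Ι (0 : ℝ) 1 = Ioc 0 1 := uIoc_of_le zero_le_one
  have main := intervalIntegral.hasDerivAt_integral_of_dominated_loc_of_deriv_le (μ := volume)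
    (F := fun v (x : ℝ) => v * density (x * v))
    (F' := fun v (x : ℝ) => density (x * v) + v * (densityDeriv (x * v) * x)) (x₀ := w)
    (bound := fun _ => A + (‖w‖ + ε) * B) (a := 0) (b := 1)
    (Metric.ball_mem_nhds w hε) ?_ ?_ ?_ ?_ ?_ ?_
  -- The integrand is the `x`-derivative of `x * density (x * w)`.
  · have key : ∫ x in (0 : ℝ)..1, (density (x * w) + w * (densityDeriv (x * w) * x)) =
        density w := by
      have := intervalIntegral.integral_eq_sub_of_hasDerivAt (a := 0) (b := 1)
        (f := fun x : ℝ => (x : ℂ) * density (x * w))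
        (f' := fun x : ℝ => density (x * w) + w * (densityDeriv (x * w) * x)) ?_ main.1
      · simpa using this
      · intro x hx
        rw [uIcc_of_le zero_le_one] at hx
        have h1 : HasDerivAt (fun x : ℂ => x * density (x * w))
            (1 * density (x * w) + x * (densityDeriv (x * w) * w)) x := by
          have h2 := hsub (hmem x hx w hwb)
          rw [mul_comm] at h2
          have h3 := hasDerivAt_density_mul h2
          simp only [mul_comm w] at h3
          exact (hasDerivAt_id' (x : ℂ)).mul h3
        exact h1.comp_ofReal.congr_deriv (by ring)
    rw [key] at main
    exact main.2
  · filter_upwards [Metric.ball_mem_nhds w hε] with v hv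
    rw [hI]
    exact ((continuousOn_const.mul (hcomp v hv _ continuousOn_density)).mono
      Ioc_subset_Icc_self).aestronglyMeasurable measurableSet_Ioc
  · apply ContinuousOn.intervalIntegrable
    rw [uIcc_of_le zero_le_one]
    exact continuousOn_const.mul (hcomp w hwb _ continuousOn_density)
  · rw [hI]
    refine ContinuousOn.aestronglyMeasurable (ContinuousOn.mono ?_ Ioc_subset_Icc_self)
      measurableSet_Ioc
    exact (hcomp w hwb _ continuousOn_density).add
      (continuousOn_const.mul ((hcomp w hwb _ continuousOn_densityDeriv).mul (by fun_prop)))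
  · refine Eventually.of_forall fun x hx v hv => ?_
    rw [hI] at hx
    have hx' := Ioc_subset_Icc_self hx
    have h1 := hA _ (hmem x hx' v hv)
    have h2 := hB _ (hmem x hx' v hv)
    have h3 : ‖v‖ ≤ ‖w‖ + ε := by
      have := norm_add_le w (v - w)
      have h4 := mem_ball_iff_norm.1 hv
      rw [add_sub_cancel] at this
      linarith
    refine (norm_add_le _ _).trans (add_le_add h1 ?_)
    rw [norm_mul, norm_mul, norm_real, Real.norm_of_nonneg hx.1.le]
    have h5 : ‖densityDeriv (x * v)‖ * x ≤ B := by
      nlinarith [norm_nonneg (densityDeriv (x * v)), hx.2, hx.1]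
    exact mul_le_mul h3 h5 (by have := hx.1.le; positivity) (by positivity)
  · exact intervalIntegrable_const
  · refine Eventually.of_forall fun x hx v hv => ?_
    rw [hI] at hx
    have h1 : HasDerivAt (fun v : ℂ => v * density (x * v))
        (1 * density (x * v) + v * (densityDeriv (x * v) * x)) v := by
      exact (hasDerivAt_id' v).mul
        (hasDerivAt_density_mul (hsub (hmem x (Ioc_subset_Icc_self hx) v hv)))
    simpa only [one_mul] using h1

lemma analyticAt_scMap {w : ℂ} (hw : w ∈ slitDomain) : AnalyticAt ℂ scMap w := by
  rw [analyticAt_iff_eventually_differentiableAt]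
  filter_upwards [isOpen_slitDomain.mem_nhds hw] with v hv
  exact (hasDerivAt_scMap hv).differentiableAt

/-! ### Continuity up to the unit circle, symmetries and special values. -/

/-- `|1 + (x * w) ^ 6| ≥ 1 - x ^ 6 ≥ 1 - x`. The bound is integrable and independent of `w`, so it
dominates even at the six corners on the circle, where `1 + w ^ 6` vanishes. -/
lemma norm_density_le {w : ℂ} (hw : ‖w‖ ≤ 1) {x : ℝ} (h0 : 0 ≤ x) (h1 : x < 1) :
    ‖density (x * w)‖ ≤ (1 - x) ^ (-(1 / 3) : ℝ) := by
  have e : (-(1 / 3) : ℂ) = ((-(1 / 3) : ℝ) : ℂ) := by push_cast; ring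
  rw [density, e, norm_cpow_real]
  refine Real.rpow_le_rpow_of_nonpos (by linarith) ?_ (by norm_num)
  have h2 := norm_sub_norm_le (1 : ℂ) (-((x : ℂ) * w) ^ 6)
  have h3 : ‖-((x : ℂ) * w) ^ 6‖ ≤ x := by
    rw [norm_neg, norm_pow, norm_mul, norm_real, Real.norm_of_nonneg h0]
    have : x * ‖w‖ ≤ x := by nlinarith
    calc (x * ‖w‖) ^ 6 ≤ x ^ 6 := by gcongr
      _ ≤ x := pow_le_of_le_one h0 h1.le (by norm_num)
  rw [sub_neg_eq_add, norm_one] at h2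
  linarith

lemma norm_ofReal_mul_lt_one {w : ℂ} (hw : ‖w‖ ≤ 1) {x : ℝ} (h0 : 0 ≤ x) (h1 : x < 1) :
    ‖(x : ℂ) * w‖ < 1 := by
  rw [norm_mul, norm_real, Real.norm_of_nonneg h0]; nlinarith [norm_nonneg w]

lemma continuousOn_density_ray {w : ℂ} (hw : ‖w‖ ≤ 1) :
    ContinuousOn (fun x : ℝ => density (x * w)) (Ico 0 1) :=
  continuousOn_density.comp (by fun_prop) fun _ hx =>
    mem_slitDomain_of_norm_lt_one (norm_ofReal_mul_lt_one hw hx.1 hx.2)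

lemma aestronglyMeasurable_density_ray {w : ℂ} (hw : ‖w‖ ≤ 1) :
    AEStronglyMeasurable (fun x : ℝ => w * density (x * w)) (volume.restrict (Ι 0 1)) := by
  rw [uIoc_of_le zero_le_one, ← restrict_Ioo_eq_restrict_Ioc]
  exact (continuousOn_const.mul ((continuousOn_density_ray hw).mono
    Ioo_subset_Ico_self)).aestronglyMeasurable measurableSet_Ioo

lemma intervalIntegrable_one_sub_rpow :
    IntervalIntegrable (fun x : ℝ => (1 - x) ^ (-(1 / 3) : ℝ)) volume 0 1 := by
  have := (intervalIntegral.intervalIntegrable_rpow' (a := 1) (b := 0)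
    (show (-1 : ℝ) < -(1 / 3) by norm_num)).comp_sub_left 1
  simpa using this

lemma ae_lt_one : ∀ᵐ x : ℝ, x ∈ Ι (0 : ℝ) 1 → 0 ≤ x ∧ x < 1 := by
  have : ∀ᵐ x : ℝ, x ≠ 1 := by simp [ae_iff]
  filter_upwards [this] with x hx h
  rw [uIoc_of_le zero_le_one] at h
  exact ⟨h.1.le, lt_of_le_of_ne h.2 hx⟩

lemma ae_norm_le {w : ℂ} (hw : ‖w‖ ≤ 1) : ∀ᵐ x : ℝ, x ∈ Ι (0 : ℝ) 1 →
    ‖w * density (x * w)‖ ≤ (1 - x) ^ (-(1 / 3) : ℝ) := by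
  filter_upwards [ae_lt_one] with x hx h
  have h1 := norm_density_le hw (hx h).1 (hx h).2
  rw [norm_mul]
  nlinarith [norm_nonneg (density (x * w)), norm_nonneg w]

lemma continuousOn_scMap : ContinuousOn scMap (Metric.closedBall 0 1) := by
  intro w hw
  refine intervalIntegral.continuousWithinAt_of_dominated_interval
    (bound := fun x : ℝ => (1 - x) ^ (-(1 / 3) : ℝ)) ?_ ?_ intervalIntegrable_one_sub_rpow ?_
  · filter_upwards [self_mem_nhdsWithin] with v hv
    exact aestronglyMeasurable_density_ray (mem_closedBall_zero_iff.1 hv)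
  · filter_upwards [self_mem_nhdsWithin] with v hv
    exact ae_norm_le (mem_closedBall_zero_iff.1 hv)
  · filter_upwards [ae_lt_one] with x hx h
    have hm := mem_slitDomain_of_norm_lt_one
      (norm_ofReal_mul_lt_one (mem_closedBall_zero_iff.1 hw) (hx h).1 (hx h).2)
    have h1 : ContinuousAt (fun v : ℂ => density (x * v)) w :=
      ContinuousAt.comp (f := fun v : ℂ => (x : ℂ) * v) (hasDerivAt_density hm).continuousAt
        (by fun_prop)
    exact (continuousAt_id.mul h1).continuousWithinAt

lemma scMap_zero : scMap 0 = 0 := by simp [scMap]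

lemma scMap_mul {u : ℂ} (hu : u ^ 6 = 1) (w : ℂ) : scMap (u * w) = u * scMap w := by
  have h : ∀ x : ℝ, density (x * (u * w)) = density (x * w) := by
    intro x; simp only [density, mul_pow, hu, one_mul]
  simp only [scMap, h, mul_assoc]
  rw [intervalIntegral.integral_const_mul]

lemma density_conj {w : ℂ} (hw : w ∈ slitDomain) : density (conj w) = conj (density w) := by
  have h : 1 + conj w ^ 6 = conj (1 + w ^ 6) := by simp
  rw [density, density, h, conj_cpow _ _ (mem_slitPlane_iff_arg.1 hw).1]
  simp only [map_neg, map_div₀, map_one, map_ofNat]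

lemma scMap_conj {w : ℂ} (hw : w ∈ slitDomain) : scMap (conj w) = conj (scMap w) := by
  rw [scMap, scMap, ← intervalIntegral.intervalIntegral_conj]
  refine intervalIntegral.integral_congr fun x hx => ?_
  rw [uIcc_of_le zero_le_one] at hx
  have := density_conj (ofReal_mul_mem_slitDomain hw hx.1 hx.2)
  simp only [map_mul, conj_ofReal] at this ⊢
  rw [this]

lemma scMap_one : scMap 1 = K := by
  rw [scMap, K, ← intervalIntegral.integral_ofReal]
  refine intervalIntegral.integral_congr fun x _ => ?_
  have h : (0 : ℝ) ≤ 1 + x ^ 6 := by positivity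
  simp only [one_mul, mul_one, density, one_div, ← Real.rpow_neg h]
  rw [ofReal_cpow h]
  push_cast; rfl

lemma delta_pow_six : δ ^ 6 = -1 := by
  rw [δ, ← Complex.exp_nat_mul]
  convert Complex.exp_pi_mul_I using 2
  push_cast; ring

lemma scMap_delta : scMap δ = δ * L := by
  rw [scMap, L, ← intervalIntegral.integral_ofReal, ← intervalIntegral.integral_const_mul]
  refine intervalIntegral.integral_congr fun x hx => ?_
  rw [uIcc_of_le zero_le_one] at hx
  have h : (0 : ℝ) ≤ 1 - x ^ 6 := by have := pow_le_one₀ hx.1 hx.2 (n := 6); linarith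
  simp only [density, one_div, ← Real.rpow_neg h, mul_pow, delta_pow_six]
  rw [ofReal_cpow h]
  push_cast; ring_nf

/-! ### Injectivity on the closed disc. -/

lemma density_eq_polar {w : ℂ} (hw : w ∈ slitDomain) :
    density w = (‖1 + w ^ 6‖ ^ (-(1 / 3) : ℝ) : ℝ) * exp ((-(arg (1 + w ^ 6) / 3) : ℝ) * I) := by
  have h0 : 1 + w ^ 6 ≠ 0 := slitPlane_ne_zero hw
  rw [density, cpow_def_of_ne_zero h0, Real.rpow_def_of_pos (norm_pos_iff.2 h0), ofReal_exp,
    ← Complex.exp_add, log]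
  congr 1
  push_cast
  ring

lemma re_density_pos {w : ℂ} (hw : ‖w‖ < 1) : 0 < (density w).re := by
  have hd := mem_slitDomain_of_norm_lt_one hw
  have h0 : 1 + w ^ 6 ≠ 0 := slitPlane_ne_zero hd
  have ha := abs_lt.1 (abs_arg_lt_pi_div_two_iff.2 (Or.inl (re_one_add_pow_pos hw)))
  rw [density_eq_polar hd, re_ofReal_mul, exp_ofReal_mul_I_re]
  have := norm_pos_iff.2 h0
  have := Real.pi_pos
  refine mul_pos (by positivity) (Real.cos_pos_of_mem_Ioo ⟨?_, ?_⟩) <;> linarith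

/-- The Noshiro-Warschawski argument: along the chord from `a` to `b` the real part of `scMap / (b -
a)` has derivative `(density _).re > 0`. Strict convexity keeps the open chord inside the open disc,
so boundary points are covered too. -/
lemma injOn_scMap : InjOn scMap (Metric.closedBall 0 1) := by
  intro a ha b hb hab
  by_contra hne
  have hne' : b - a ≠ 0 := sub_ne_zero.2 (Ne.symm hne)
  have hseg : ∀ x ∈ Icc (0 : ℝ) 1, a + x * (b - a) ∈ Metric.closedBall (0 : ℂ) 1 := by
    intro x hx
    have := (convex_closedBall (0 : ℂ) 1).add_smul_sub_mem ha hb hx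
    simpa [real_smul] using this
  have hseg' : ∀ x ∈ Ioo (0 : ℝ) 1, ‖a + x * (b - a)‖ < 1 := by
    intro x hx
    have h := (strictConvex_closedBall ℝ (0 : ℂ) 1) ha hb hne (sub_pos.2 hx.2) hx.1
      (sub_add_cancel 1 x)
    rw [interior_closedBall _ one_ne_zero, mem_ball_zero_iff] at h
    have e : (1 - x) • a + x • b = a + x * (b - a) := by
      simp only [real_smul]; push_cast; ring
    rwa [e] at h
  set φ : ℝ → ℝ := fun x => (scMap (a + x * (b - a)) / (b - a)).re with hφ
  have hmono : StrictMonoOn φ (Icc 0 1) := by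
    refine strictMonoOn_of_deriv_pos (convex_Icc 0 1) ?_ ?_
    · refine continuous_re.comp_continuousOn (ContinuousOn.div_const ?_ _)
      exact continuousOn_scMap.comp (by fun_prop) hseg
    · intro x hx
      rw [interior_Icc] at hx
      have h1 : HasDerivAt (fun x : ℂ => a + x * (b - a)) (b - a) x := by
        simpa using ((hasDerivAt_id (x : ℂ)).mul_const (b - a)).const_add a
      have h2 : HasDerivAt (fun x : ℂ => scMap (a + x * (b - a)) / (b - a))
          (density (a + x * (b - a)) * (b - a) / (b - a)) x :=
        ((hasDerivAt_scMap (mem_slitDomain_of_norm_lt_one (hseg' x hx))).comp (x : ℂ)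
          h1).div_const _
      rw [mul_div_cancel_right₀ _ hne'] at h2
      rw [hφ, h2.real_of_complex.deriv]
      exact re_density_pos (hseg' x hx)
  have := hmono (left_mem_Icc.2 zero_le_one) (right_mem_Icc.2 zero_le_one) zero_lt_one
  simp [hφ, hab] at this

/-! ### Reflection in the unit circle and the image of an arc. -/

/-- The horizontal strip that `exp` maps onto a sector of opening `π / 3`. -/
def strip : Set ℂ := {ζ | |ζ.im| < Real.pi / 6}

lemma isOpen_strip : IsOpen strip := isOpen_lt (by fun_prop) continuous_const

lemma isPreconnected_strip : IsPreconnected strip := by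
  have : strip = im ⁻¹' Ioo (-(Real.pi / 6)) (Real.pi / 6) := by
    ext ζ; simp [strip, abs_lt]
  rw [this]
  exact ((convex_Ioo _ _).linear_preimage imLm).isPreconnected

lemma neg_mem_strip {ζ : ℂ} (h : ζ ∈ strip) : -ζ ∈ strip := by simpa [strip] using h

lemma one_add_exp_pow_im (ζ : ℂ) :
    (1 + exp ζ ^ 6).im = Real.exp (6 * ζ.re) * Real.sin (6 * ζ.im) := by
  rw [← Complex.exp_nat_mul, add_im, exp_im]; simp

lemma one_add_exp_pow_re (ζ : ℂ) :
    (1 + exp ζ ^ 6).re = 1 + Real.exp (6 * ζ.re) * Real.cos (6 * ζ.im) := by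
  rw [← Complex.exp_nat_mul, add_re, exp_re]; simp

lemma exp_mem_slitDomain {ζ : ℂ} (h : ζ ∈ strip) : exp ζ ∈ slitDomain := by
  have h' := abs_lt.1 (show |ζ.im| < Real.pi / 6 from h)
  rw [slitDomain, mem_ofPred_eq, mem_slitPlane_iff, one_add_exp_pow_re, one_add_exp_pow_im]
  by_cases h0 : ζ.im = 0
  · left; simp only [h0, mul_zero, Real.cos_zero, mul_one]; positivity
  · right
    refine mul_ne_zero (Real.exp_pos _).ne' fun hs => h0 ?_
    have := (Real.sin_eq_zero_iff_of_lt_of_lt (by linarith) (by linarith)).1 hs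
    linarith

lemma arg_one_add_exp_pow_nonneg {ζ : ℂ} (h : |ζ.im| ≤ Real.pi / 6) (h0 : 0 ≤ ζ.im) :
    0 ≤ arg (1 + exp ζ ^ 6) := by
  rw [arg_nonneg_iff, one_add_exp_pow_im]
  have h' := abs_le.1 h
  exact mul_nonneg (Real.exp_pos _).le
    (Real.sin_nonneg_of_nonneg_of_le_pi (by linarith) (by linarith))

lemma arg_one_add_exp_pow_nonpos {ζ : ℂ} (h : ζ ∈ strip) (h0 : ζ.im < 0) :
    arg (1 + exp ζ ^ 6) < 0 := by
  rw [arg_neg_iff, one_add_exp_pow_im]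
  have h' := abs_lt.1 (show |ζ.im| < Real.pi / 6 from h)
  exact mul_neg_of_pos_of_neg (Real.exp_pos _)
    (Real.sin_neg_of_neg_of_neg_pi_lt (by linarith) (by linarith))

/-- Both sides exponentiate to `1 + exp (-6 * ζ)`. They are the same branch because `arg (1 + exp (6
* ζ))` has the sign of `ζ.im`, so subtracting `6 * ζ.im` stays within `(-π, π]`. -/
lemma log_one_add_exp_neg {ζ : ℂ} (h : ζ ∈ strip) :
    log (1 + exp (-ζ) ^ 6) = log (1 + exp ζ ^ 6) - 6 * ζ := by
  have h' := abs_lt.1 (show |ζ.im| < Real.pi / 6 from h)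
  have hd := exp_mem_slitDomain h
  have hd' := exp_mem_slitDomain (neg_mem_strip h)
  have hlt := (arg_le_pi (1 + exp ζ ^ 6)).lt_of_ne (mem_slitPlane_iff_arg.1 hd).1
  have hgt := neg_pi_lt_arg (1 + exp ζ ^ 6)
  have him : (log (1 + exp ζ ^ 6) - 6 * ζ).im = arg (1 + exp ζ ^ 6) - 6 * ζ.im := by
    simp [log_im]
  refine exp_inj_of_neg_pi_lt_of_le_pi (neg_pi_lt_log_im _) (log_im_le_pi _) ?_ ?_ ?_
  · rw [him]
    rcases le_or_gt 0 ζ.im with h0 | h0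
    · have := arg_one_add_exp_pow_nonneg (le_of_lt h) h0; linarith
    · linarith
  · rw [him]
    rcases le_or_gt 0 ζ.im with h0 | h0
    · linarith
    · have := arg_one_add_exp_pow_nonpos h h0; linarith
  · rw [Complex.exp_sub, exp_log (slitPlane_ne_zero hd), exp_log (slitPlane_ne_zero hd'),
      Complex.exp_neg, inv_pow, ← Complex.exp_nat_mul]
    have := Complex.exp_ne_zero (6 * ζ)
    push_cast
    field_simp
    ring

lemma density_exp_neg {ζ : ℂ} (h : ζ ∈ strip) :
    density (exp (-ζ)) * exp (-ζ) = density (exp ζ) * exp ζ := by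
  rw [density, density, cpow_def_of_ne_zero (slitPlane_ne_zero (exp_mem_slitDomain h)),
    cpow_def_of_ne_zero (slitPlane_ne_zero (exp_mem_slitDomain (neg_mem_strip h))),
    log_one_add_exp_neg h, ← Complex.exp_add, ← Complex.exp_add]
  congr 1
  ring

/-- In the coordinate `w = exp ζ` the form `density w dw` is an even function of `ζ` times `dζ`, so
the sum has derivative zero; its value is read off at `ζ = 0`. -/
lemma scMap_exp_add_scMap_exp_neg {ζ : ℂ} (h : ζ ∈ strip) :
    scMap (exp ζ) + scMap (exp (-ζ)) = 2 * K := by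
  have hder : ∀ η ∈ strip, HasDerivAt (fun η => scMap (exp η) + scMap (exp (-η))) 0 η := by
    intro η hη
    have h1 := (hasDerivAt_scMap (exp_mem_slitDomain hη)).comp η (Complex.hasDerivAt_exp η)
    have h2 := (hasDerivAt_scMap (exp_mem_slitDomain (neg_mem_strip hη))).comp η
      (hasDerivAt_neg η).cexp
    refine (h1.add h2).congr_deriv ?_
    have := density_exp_neg hη
    linear_combination -this
  have h0 : (0 : ℂ) ∈ strip := by simp [strip, Real.pi_pos]
  have := isOpen_strip.is_const_of_deriv_eq_zero isPreconnected_strip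
    (fun η hη => (hder η hη).differentiableAt.differentiableWithinAt)
    (fun η hη => (hder η hη).deriv) h h0
  simp only [neg_zero, Complex.exp_zero, scMap_one] at this
  rw [this]; ring

lemma norm_exp_ofReal_mul_I_le (θ : ℝ) : exp (θ * I) ∈ Metric.closedBall (0 : ℂ) 1 := by
  simp [norm_exp_ofReal_mul_I]

lemma continuous_scMap_circle : Continuous fun θ : ℝ => scMap (exp (θ * I)) :=
  continuousOn_scMap.comp_continuous (by fun_prop) norm_exp_ofReal_mul_I_le

/-- On the circle `exp (-ζ)` is the conjugate of `exp ζ`, so the reflection identity reads `2 * re =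
2 * K`. The end points, where the density is singular, follow by continuity. -/
lemma re_scMap_circle {θ : ℝ} (h : |θ| ≤ Real.pi / 6) : (scMap (exp (θ * I))).re = K := by
  have hpi := Real.pi_pos
  have hEq : EqOn (fun θ : ℝ => (scMap (exp (θ * I))).re) (fun _ => K)
      (Ioo (-(Real.pi / 6)) (Real.pi / 6)) := by
    intro θ hθ
    have hs : (θ * I : ℂ) ∈ strip := by simpa [strip, abs_lt] using hθ
    have h1 := scMap_exp_add_scMap_exp_neg hs
    have h2 : exp (-(θ * I : ℂ)) = conj (exp (θ * I)) := by
      rw [← exp_conj]; simp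
    rw [h2, scMap_conj (exp_mem_slitDomain hs), add_conj] at h1
    have h3 := congrArg re h1
    simp at h3
    exact h3
  have := hEq.closure (continuous_re.comp continuous_scMap_circle) continuous_const
  rw [closure_Ioo (by linarith)] at this
  exact this (abs_le.1 h)

lemma delta_eq : δ = exp ((Real.pi / 6 : ℝ) * I) := by
  rw [δ]; congr 1; push_cast; ring

lemma delta_re : δ.re = Real.sqrt 3 / 2 := by
  rw [delta_eq, exp_ofReal_mul_I_re, Real.cos_pi_div_six]

lemma delta_im : δ.im = 1 / 2 := by
  rw [delta_eq, exp_ofReal_mul_I_im, Real.sin_pi_div_six]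

lemma K_eq : K = Real.sqrt 3 / 2 * L := by
  have hpi := Real.pi_pos
  have := re_scMap_circle (θ := Real.pi / 6) (abs_of_pos (by positivity)).le
  rw [← delta_eq, scMap_delta, re_mul_ofReal, delta_re] at this
  exact this.symm

/-- A crude bound on the integrand, enough for `K_pos` and `r_lt_K`. -/
lemma half_le_K : 1 / 2 ≤ K := by
  have h : ∫ _ in (0 : ℝ)..1, (1 / 2 : ℝ) ≤ K := by
    have hc : ∀ x : ℝ, 1 + x ^ 6 ≠ 0 := fun x => by positivity
    refine intervalIntegral.integral_mono_on zero_le_one (by simp) ?_ ?_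
    · apply Continuous.intervalIntegrable
      refine continuous_const.div (Continuous.rpow_const (by fun_prop) fun x => Or.inl (hc x)) ?_
      intro x
      have : (0 : ℝ) < 1 + x ^ 6 := by positivity
      positivity
    · intro x hx
      have h0 : (0 : ℝ) < 1 + x ^ 6 := by positivity
      have h1 : 1 + x ^ 6 ≤ 2 := by have := pow_le_one₀ hx.1 hx.2 (n := 6); linarith
      refine one_div_le_one_div_of_le (by positivity) ?_
      calc (1 + x ^ 6) ^ (1 / 3 : ℝ) ≤ (1 + x ^ 6) ^ (1 : ℝ) :=
            Real.rpow_le_rpow_of_exponent_le (by nlinarith [pow_nonneg hx.1 6]) (by norm_num)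
        _ ≤ 2 := by rwa [Real.rpow_one]
  simpa using h

lemma K_pos : 0 < K := by have := half_le_K; linarith

lemma L_pos : 0 < L := by
  have := K_pos
  rw [K_eq] at this
  exact pos_of_mul_pos_right this (by positivity)

/-! ### The image of a sector of the disc. -/

/-- This angle is the argument of the radial derivative of `scMap`. The `arg` has the sign of `θ`
and is at most `π / 2` in size, so `θ` and `arg / 3` are two numbers of equal sign, each at most `π
/ 6` in size. -/
lemma arg_one_add_circle {ρ θ : ℝ} (h0 : 0 ≤ ρ) (h1 : ρ < 1) (hθ : |θ| ≤ Real.pi / 6) :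
    |θ - arg (1 + (ρ * exp (θ * I)) ^ 6) / 3| ≤ Real.pi / 6 := by
  have hpi := Real.pi_pos
  have hn : ‖(ρ : ℂ) * exp (θ * I)‖ < 1 := by
    rw [norm_mul, norm_exp_ofReal_mul_I, mul_one, norm_real, Real.norm_of_nonneg h0]; exact h1
  have ha := abs_le.1 (abs_arg_le_pi_div_two_iff.2 (re_one_add_pow_pos hn).le)
  have him : (1 + ((ρ : ℂ) * exp (θ * I)) ^ 6).im = ρ ^ 6 * Real.sin (6 * θ) := by
    have e : ((6 : ℕ) : ℂ) * (θ * I) = (6 * θ : ℝ) * I := by push_cast; ring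
    rw [mul_pow, ← Complex.exp_nat_mul, ← ofReal_pow, e, add_im, im_ofReal_mul, one_im,
      exp_ofReal_mul_I_im, zero_add]
  have hθ' := abs_le.1 hθ
  rw [abs_le]
  rcases le_total 0 θ with h | h
  · have : 0 ≤ arg (1 + ((ρ : ℂ) * exp (θ * I)) ^ 6) := by
      rw [arg_nonneg_iff, him]
      exact mul_nonneg (by positivity)
        (Real.sin_nonneg_of_nonneg_of_le_pi (by linarith) (by linarith))
    constructor <;> linarith
  · have : arg (1 + ((ρ : ℂ) * exp (θ * I)) ^ 6) ≤ 0 := by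
      rcases (mul_nonpos_of_nonneg_of_nonpos (pow_nonneg h0 6)
        (Real.sin_nonpos_of_nonpos_of_neg_pi_le (x := 6 * θ) (by linarith)
          (by linarith))).lt_or_eq with h2 | h2
      · exact (arg_neg_iff.2 (him ▸ h2)).le
      · rw [← him] at h2
        exact (arg_eq_zero_iff.2 ⟨(re_one_add_pow_pos hn).le, h2⟩).le
    constructor <;> linarith

lemma exists_polar_density {ρ θ : ℝ} (h0 : 0 ≤ ρ) (h1 : ρ < 1) (hθ : |θ| ≤ Real.pi / 6) :
    ∃ R β : ℝ, 0 ≤ R ∧ |β| ≤ Real.pi / 6 ∧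
      exp (θ * I) * density (ρ * exp (θ * I)) = R * exp (β * I) := by
  refine ⟨‖1 + ((ρ : ℂ) * exp (θ * I)) ^ 6‖ ^ (-(1 / 3) : ℝ), _, ?_,
    arg_one_add_circle h0 h1 hθ, ?_⟩
  · positivity
  · have hn : ‖(ρ : ℂ) * exp (θ * I)‖ < 1 := by
      rw [norm_mul, norm_exp_ofReal_mul_I, mul_one, norm_real, Real.norm_of_nonneg h0]; exact h1
    rw [density_eq_polar (mem_slitDomain_of_norm_lt_one hn), mul_left_comm, ← Complex.exp_add]
    congr 2
    push_cast; ring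

lemma re_density_direction_nonneg {ρ θ τ : ℝ} (h0 : 0 ≤ ρ) (h1 : ρ < 1)
    (hθ : |θ| ≤ Real.pi / 6) (hτ : |τ| ≤ Real.pi / 3) :
    0 ≤ (exp (τ * I) * (exp (θ * I) * density (ρ * exp (θ * I)))).re := by
  obtain ⟨R, β, hR, hβ, he⟩ := exists_polar_density h0 h1 hθ
  rw [he, mul_left_comm, ← Complex.exp_add, ← add_mul, ← ofReal_add, re_ofReal_mul,
    exp_ofReal_mul_I_re]
  have h2 := abs_le.1 hβ
  have h3 := abs_le.1 hτ
  exact mul_nonneg hR (Real.cos_nonneg_of_mem_Icc ⟨by linarith, by linarith⟩)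

lemma ofReal_mul_exp_mem_closedBall {ρ : ℝ} (h : ρ ∈ Icc (0 : ℝ) 1) (θ : ℝ) :
    (ρ : ℂ) * exp (θ * I) ∈ Metric.closedBall (0 : ℂ) 1 := by
  rw [mem_closedBall_zero_iff, norm_mul, norm_exp_ofReal_mul_I, mul_one, norm_real,
    Real.norm_of_nonneg h.1]
  exact h.2

/-- Used with `τ = 0` for the outer side of the triangle and `τ = ±π / 3` for its two sides through
`0`. -/
lemma monotoneOn_re_scMap_ray {θ τ : ℝ} (hθ : |θ| ≤ Real.pi / 6) (hτ : |τ| ≤ Real.pi / 3) :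
    MonotoneOn (fun ρ : ℝ => (exp (τ * I) * scMap (ρ * exp (θ * I))).re) (Icc 0 1) := by
  have hder : ∀ ρ ∈ Ioo (0 : ℝ) 1,
      HasDerivAt (fun ρ : ℝ => (exp (τ * I) * scMap (ρ * exp (θ * I))).re)
        (exp (τ * I) * (exp (θ * I) * density (ρ * exp (θ * I)))).re ρ := by
    intro ρ hρ
    have hn : ‖(ρ : ℂ) * exp (θ * I)‖ < 1 := by
      rw [norm_mul, norm_exp_ofReal_mul_I, mul_one, norm_real, Real.norm_of_nonneg hρ.1.le]
      exact hρ.2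
    have h1 : HasDerivAt (fun z : ℂ => z * exp (θ * I)) (exp (θ * I)) ρ := by
      simpa using (hasDerivAt_id (ρ : ℂ)).mul_const (exp (θ * I))
    have h2 := (((hasDerivAt_scMap (mem_slitDomain_of_norm_lt_one hn)).comp (ρ : ℂ) h1).const_mul
      (exp (τ * I))).real_of_complex
    rwa [mul_comm (density _)] at h2
  refine monotoneOn_of_deriv_nonneg (convex_Icc 0 1) ?_ ?_ ?_
  · refine continuous_re.comp_continuousOn (continuousOn_const.mul ?_)
    exact continuousOn_scMap.comp (by fun_prop) fun ρ hρ => ofReal_mul_exp_mem_closedBall hρ θ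
  · intro ρ hρ
    rw [interior_Icc] at hρ
    exact (hder ρ hρ).differentiableAt.differentiableWithinAt
  · intro ρ hρ
    rw [interior_Icc] at hρ
    rw [(hder ρ hρ).deriv]
    exact re_density_direction_nonneg hρ.1.le hρ.2 hθ hτ

lemma re_scMap_ray_nonneg {ρ θ τ : ℝ} (hρ : ρ ∈ Icc (0 : ℝ) 1) (hθ : |θ| ≤ Real.pi / 6)
    (hτ : |τ| ≤ Real.pi / 3) : 0 ≤ (exp (τ * I) * scMap (ρ * exp (θ * I))).re := by
  simpa [scMap_zero] using
    monotoneOn_re_scMap_ray hθ hτ (left_mem_Icc.2 zero_le_one) hρ hρ.1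

lemma re_scMap_ray_le {ρ θ : ℝ} (hρ : ρ ∈ Icc (0 : ℝ) 1) (hθ : |θ| ≤ Real.pi / 6) :
    (scMap (ρ * exp (θ * I))).re ≤ K := by
  have hpi := Real.pi_pos
  have := monotoneOn_re_scMap_ray (τ := 0) hθ (by simp; positivity) hρ
    (right_mem_Icc.2 zero_le_one) hρ.2
  simp only [ofReal_zero, zero_mul, Complex.exp_zero, one_mul, ofReal_one] at this
  rwa [re_scMap_circle hθ] at this

/-- Every complex number lies in the closed sector `|arg| ≤ π / 6` up to a sixth root of unity. -/
lemma exists_sector (w : ℂ) :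
    ∃ u : ℂ, u ^ 6 = 1 ∧ ∃ θ : ℝ, |θ| ≤ Real.pi / 6 ∧ w = u * (‖w‖ * exp (θ * I)) := by
  have hpi := Real.pi_pos
  set m : ℤ := round (arg w / (Real.pi / 3)) with hm
  refine ⟨exp ((m * (Real.pi / 3) : ℝ) * I), ?_, arg w - m * (Real.pi / 3), ?_, ?_⟩
  · rw [← Complex.exp_nat_mul, Complex.exp_eq_one_iff]
    exact ⟨m, by push_cast; ring⟩
  · have h := abs_sub_round (arg w / (Real.pi / 3))
    have e : arg w - m * (Real.pi / 3) = (arg w / (Real.pi / 3) - m) * (Real.pi / 3) := by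
      field_simp
    rw [e, abs_mul, abs_of_pos (by positivity : 0 < Real.pi / 3)]
    rw [← hm] at h
    nlinarith
  · rw [mul_left_comm, ← Complex.exp_add, ← add_mul, ← ofReal_add, add_sub_cancel]
    exact (norm_mul_exp_arg_mul_I w).symm

lemma gamma_pow_six : γ ^ 6 = 1 := by
  rw [γ, ← Complex.exp_nat_mul, Complex.exp_eq_one_iff]
  exact ⟨1, by push_cast; ring⟩

lemma gamma_eq_sq : γ = δ ^ 2 := by
  rw [γ, δ, ← Complex.exp_nat_mul]; congr 1; push_cast; ring

lemma isPrimitiveRoot_gamma : IsPrimitiveRoot γ 6 := by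
  have := isPrimitiveRoot_exp 6 (by norm_num)
  convert this using 1
  rw [γ]; congr 1; push_cast; ring

lemma delta_ne_zero : δ ≠ 0 := Complex.exp_ne_zero _

lemma conj_delta : conj δ = δ⁻¹ := by
  rw [delta_eq, ← exp_conj, ← Complex.exp_neg, map_mul, conj_ofReal, conj_I, mul_neg]

/-! ### The image of the disc is the hexagon. -/

/-- The vertices of `hexagon`. -/
lemma range_vertices :
    (range fun k : Fin 6 => (L : ℂ) * γ ^ (k : ℕ)) = {v | ∃ u : ℂ, u ^ 6 = 1 ∧ v = L * u} := by
  ext v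
  constructor
  · rintro ⟨k, rfl⟩
    refine ⟨γ ^ (k : ℕ), ?_, rfl⟩
    rw [← pow_mul, mul_comm, pow_mul, gamma_pow_six, one_pow]
  · rintro ⟨u, hu, rfl⟩
    obtain ⟨i, hi, rfl⟩ := isPrimitiveRoot_gamma.eq_pow_of_pow_eq_one hu
    exact ⟨⟨i, hi⟩, rfl⟩

lemma re_delta_mul_le {u : ℂ} (hu : u ^ 6 = 1) : (δ * u).re ≤ Real.sqrt 3 / 2 := by
  set v := δ * u with hv
  have h6 : v ^ 6 = -1 := by rw [hv, mul_pow, hu, delta_pow_six, mul_one]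
  have hn : ‖v‖ = 1 := by
    have : ‖v‖ ^ 6 = 1 := by rw [← norm_pow, h6]; simp
    exact (pow_eq_one_iff_of_nonneg (norm_nonneg _) (by norm_num)).1 this
  have h2 : v.re ^ 2 + v.im ^ 2 = 1 := by
    have := Complex.sq_norm v
    rw [hn, normSq_apply] at this; linarith
  have hre : (v ^ 6).re = -1 := by rw [h6]; simp
  have hexp : (v ^ 6).re = v.re ^ 6 - 15 * v.re ^ 4 * v.im ^ 2 + 15 * v.re ^ 2 * (v.im ^ 2) ^ 2
      - (v.im ^ 2) ^ 3 := by
    simp only [pow_succ, pow_zero, one_mul, mul_re, mul_im]; ring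
  have him : v.im ^ 2 = 1 - v.re ^ 2 := by linarith
  rw [hre, him] at hexp
  -- With `|v| = 1`, `re (v ^ 6) + 1` is twice this product, so `v.re ^ 2` is `0` or `3 / 4`.
  have hp : v.re ^ 2 * (4 * v.re ^ 2 - 3) ^ 2 = 0 := by linear_combination (-1/2) * hexp
  have h3 : v.re ^ 2 ≤ 3 / 4 := by
    rcases mul_eq_zero.1 hp with h | h
    · rw [h]; norm_num
    · have := pow_eq_zero_iff (two_ne_zero) |>.1 h; linarith
  have : v.re ≤ Real.sqrt (3 / 4) := Real.le_sqrt_of_sq_le h3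
  rwa [Real.sqrt_div' _ (by norm_num), show (4 : ℝ) = 2 ^ 2 by norm_num,
    Real.sqrt_sq (by norm_num)] at this

lemma re_lt_of_mem_hexagon {y : ℂ} (hy : y ∈ hexagon) {u : ℂ} (hu : u ^ 6 = 1) :
    (u * (δ * y)).re < K := by
  set f : ℂ →L[ℝ] ℂ := (ContinuousLinearMap.mul ℝ ℂ (u * δ)) with hf
  have hsub : convexHull ℝ (range fun k : Fin 6 => (L : ℂ) * γ ^ (k : ℕ)) ⊆
      f ⁻¹' {z | z.re ≤ K} := by
    refine convexHull_min ?_ ((convex_halfSpace_re_le K).linear_preimage f.toLinearMap)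
    rw [range_vertices]
    rintro _ ⟨v, hv, rfl⟩
    have h := re_delta_mul_le (show (u * v) ^ 6 = 1 by rw [mul_pow, hu, hv, one_mul])
    have e : f (L * v) = L * (δ * (u * v)) := by simp [hf]; ring
    change (f (L * v)).re ≤ K
    rw [e, re_ofReal_mul, K_eq]
    nlinarith [L_pos]
  have hc : u * δ ≠ 0 := by
    refine mul_ne_zero (fun h => ?_) delta_ne_zero
    rw [h] at hu; norm_num at hu
  have h1 : hexagon ⊆ f ⁻¹' {z | z.re < K} := by
    have ho : IsOpenMap f := (Homeomorph.mulLeft₀ (u * δ) hc).isOpenMap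
    have h2 := interior_mono hsub
    rw [← ho.preimage_interior_eq_interior_preimage f.continuous, interior_setOfPred_re_le] at h2
    exact h2
  have := h1 hy
  simpa [hf, mul_assoc] using this

lemma isOpen_image_scMap : IsOpen (scMap '' Metric.ball 0 1) := by
  rw [isOpen_iff_mem_nhds]
  rintro _ ⟨w, hw, rfl⟩
  have hd : ∀ v ∈ Metric.ball (0 : ℂ) 1, v ∈ slitDomain := fun v hv =>
    mem_slitDomain_of_norm_lt_one (mem_ball_zero_iff.1 hv)
  have hs := (analyticAt_scMap (hd w hw)).hasStrictDerivAt
  rw [(hasDerivAt_scMap (hd w hw)).deriv] at hs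
  rw [← hs.map_nhds_eq (density_ne_zero (hd w hw))]
  exact image_mem_map (Metric.isOpen_ball.mem_nhds hw)

/-- The three inequalities cut out the triangle with vertices `0`, `L * δ`, `L * δ⁻¹`;
multiplication by `δ⁻¹ * u` carries it to the one spanned by the centre and two adjacent vertices of
`hexagon`. -/
lemma triangle_subset_hull {z u : ℂ} (hu : u ^ 6 = 1)
    (h1 : 0 ≤ (exp ((Real.pi / 3 : ℝ) * I) * z).re)
    (h2 : 0 ≤ (exp ((-(Real.pi / 3) : ℝ) * I) * z).re) (h3 : z.re ≤ K) :
    δ⁻¹ * (u * z) ∈ convexHull ℝ (range fun k : Fin 6 => (L : ℂ) * γ ^ (k : ℕ)) := by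
  have hL := L_pos
  have h3' : Real.sqrt 3 ^ 2 = 3 := Real.sq_sqrt (by norm_num)
  have h30 : 0 < Real.sqrt 3 := by positivity
  rw [mul_re, exp_ofReal_mul_I_re, exp_ofReal_mul_I_im, Real.cos_pi_div_three,
    Real.sin_pi_div_three] at h1
  rw [mul_re, exp_ofReal_mul_I_re, exp_ofReal_mul_I_im, Real.cos_neg, Real.sin_neg,
    Real.cos_pi_div_three, Real.sin_pi_div_three] at h2
  rw [K_eq] at h3
  set V := range fun k : Fin 6 => (L : ℂ) * γ ^ (k : ℕ) with hV
  have hmem : ∀ v : ℂ, v ^ 6 = 1 → (L : ℂ) * v ∈ convexHull ℝ V := fun v hv =>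
    subset_convexHull ℝ V (by rw [hV, range_vertices]; exact ⟨v, hv, rfl⟩)
  have hconv := convex_convexHull ℝ V
  have h0 : (0 : ℂ) ∈ convexHull ℝ V := by
    have := hconv (hmem 1 (by norm_num)) (hmem (-1) (by norm_num))
      (show (0 : ℝ) ≤ 1 / 2 by norm_num) (show (0 : ℝ) ≤ 1 / 2 by norm_num) (by norm_num)
    simpa using this
  set a : ℝ := (z.re / Real.sqrt 3 + z.im) / L with ha
  set b : ℝ := (z.re / Real.sqrt 3 - z.im) / L with hb
  have ha0 : 0 ≤ a := by
    refine div_nonneg ?_ hL.le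
    have : z.re / Real.sqrt 3 + z.im =
        (2 / Real.sqrt 3) * (1 / 2 * z.re - -(Real.sqrt 3 / 2) * z.im) := by
      field_simp
      ring
    rw [this]; positivity
  have hb0 : 0 ≤ b := by
    refine div_nonneg ?_ hL.le
    have : z.re / Real.sqrt 3 - z.im =
        (2 / Real.sqrt 3) * (1 / 2 * z.re - Real.sqrt 3 / 2 * z.im) := by
      field_simp
    rw [this]; positivity
  have hab : a + b ≤ 1 := by
    rw [ha, hb, ← add_div, div_le_one hL]
    have : z.re / Real.sqrt 3 ≤ L / 2 := by rw [div_le_iff₀ h30]; linarith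
    linarith
  have hz : z = a * (L * δ) + b * (L * δ⁻¹) := by
    rw [← conj_delta]
    apply Complex.ext
    · simp only [add_re, re_ofReal_mul, conj_re, delta_re, ha, hb]
      field_simp; ring
    · simp only [add_im, im_ofReal_mul, conj_im, delta_im, ha, hb]
      field_simp; ring
  have hgi : (u * γ⁻¹) ^ 6 = 1 := by rw [mul_pow, inv_pow, gamma_pow_six, hu]; norm_num
  have he : δ⁻¹ * (u * z) =
      (1 - a - b) • (0 : ℂ) + a • ((L : ℂ) * u) + b • ((L : ℂ) * (u * γ⁻¹)) := by
    rw [hz, gamma_eq_sq, smul_zero, zero_add, real_smul, real_smul]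
    have := delta_ne_zero
    field_simp
  rw [he]
  have := hconv.sum_mem (t := Finset.univ) (w := ![1 - a - b, a, b])
    (z := ![0, (L : ℂ) * u, (L : ℂ) * (u * γ⁻¹)]) ?_ ?_ ?_
  · simpa [Fin.sum_univ_three] using this
  · intro i _; fin_cases i <;> simp <;> linarith
  · simp only [Fin.sum_univ_three, Matrix.cons_val]; ring
  · intro i _; fin_cases i
    · exact h0
    · exact hmem _ hu
    · exact hmem _ hgi

lemma scMap_mem_hexagon {w : ℂ} (hw : w ∈ Metric.ball (0 : ℂ) 1) : δ⁻¹ * scMap w ∈ hexagon := by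
  have hpi := Real.pi_pos
  -- The sector estimates only reach the closed hull; openness of the image upgrades this to its
  -- interior.
  have hopen : IsOpen ((fun y => δ * y) ⁻¹' (scMap '' Metric.ball 0 1)) :=
    isOpen_image_scMap.preimage (by fun_prop)
  refine interior_maximal (t := (fun y => δ * y) ⁻¹' (scMap '' Metric.ball 0 1)) ?_ hopen ?_
  · rintro y ⟨v, hv, hy⟩
    have e : y = δ⁻¹ * scMap v := by rw [hy, inv_mul_cancel_left₀ delta_ne_zero]
    obtain ⟨u, hu, θ, hθ, hv'⟩ := exists_sector v
    have hρ : ‖v‖ ∈ Icc (0 : ℝ) 1 := ⟨norm_nonneg _, (mem_ball_zero_iff.1 hv).le⟩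
    rw [e, hv', scMap_mul hu]
    refine triangle_subset_hull hu (re_scMap_ray_nonneg hρ hθ ?_) (re_scMap_ray_nonneg hρ hθ ?_)
      (re_scMap_ray_le hρ hθ)
    · rw [abs_of_pos (by positivity)]
    · rw [abs_neg, abs_of_pos (by positivity)]
  · rw [mem_preimage, mul_inv_cancel_left₀ delta_ne_zero]
    exact mem_image_of_mem _ hw

/-- A preconnected set through `0` that avoids the image of the circle lies in the image of the
disc. -/
lemma subset_image_scMap {U : Set ℂ} (hU : IsPreconnected U) (h0 : (0 : ℂ) ∈ U)
    (hc : ∀ z ∈ U, ∀ u : ℂ, u ^ 6 = 1 → (u * z).re ≠ K) : U ⊆ scMap '' Metric.ball 0 1 := by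
  have hcl : IsClosed (scMap '' Metric.closedBall 0 1) :=
    ((isCompact_closedBall (0 : ℂ) 1).image_of_continuousOn continuousOn_scMap).isClosed
  -- `U` is covered by two disjoint open sets, the image of the open disc and the complement of the
  -- image of the closed disc; only the image of the circle is missed, and `U` avoids it.
  refine hU.subset_left_of_subset_union isOpen_image_scMap hcl.isOpen_compl ?_ ?_
    ⟨0, h0, 0, Metric.mem_ball_self one_pos, scMap_zero⟩
  · exact disjoint_compl_right.mono_left (image_mono Metric.ball_subset_closedBall)
  · intro z hz
    by_cases h : z ∈ scMap '' Metric.closedBall 0 1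
    · obtain ⟨w, hw, rfl⟩ := h
      left
      refine ⟨w, ?_, rfl⟩
      rw [mem_ball_zero_iff]
      refine lt_of_le_of_ne (mem_closedBall_zero_iff.1 hw) fun h1 => ?_
      obtain ⟨u, hu, θ, hθ, hw'⟩ := exists_sector w
      rw [h1, ofReal_one, one_mul] at hw'
      have hu0 : u ≠ 0 := fun h => by rw [h] at hu; norm_num at hu
      refine hc _ hz u⁻¹ (by rw [inv_pow, hu, inv_one]) ?_
      rw [hw', scMap_mul hu, inv_mul_cancel_left₀ hu0, re_scMap_circle hθ]
    · exact Or.inr h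

/-- `K` is the inradius: the six lines lie at distance `K` from `0`. -/
lemma ball_subset_image_scMap : Metric.ball (0 : ℂ) K ⊆ scMap '' Metric.ball 0 1 := by
  refine subset_image_scMap (convex_ball _ _).isPreconnected (Metric.mem_ball_self K_pos) ?_
  intro z hz u hu h
  have hn : ‖u‖ = 1 := by
    have : ‖u‖ ^ 6 = 1 := by rw [← norm_pow, hu]; simp
    exact (pow_eq_one_iff_of_nonneg (norm_nonneg _) (by norm_num)).1 this
  have h1 := re_le_norm (u * z)
  rw [norm_mul, hn, one_mul, h] at h1
  exact absurd (mem_ball_zero_iff.1 hz) (not_lt.2 h1)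

lemma image_hexagon : (fun y => δ * y) '' hexagon = scMap '' Metric.ball 0 1 := by
  apply Subset.antisymm
  · refine subset_image_scMap ?_ ?_ ?_
    · exact (convex_convexHull ℝ _).interior.isPreconnected.image _ (by fun_prop)
    · refine ⟨0, ?_, mul_zero _⟩
      simpa [scMap_zero] using scMap_mem_hexagon (Metric.mem_ball_self one_pos)
    · rintro _ ⟨y, hy, rfl⟩ u hu
      exact (re_lt_of_mem_hexagon hy hu).ne
  · rintro _ ⟨w, hw, rfl⟩
    exact ⟨_, scMap_mem_hexagon hw, mul_inv_cancel_left₀ delta_ne_zero _⟩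

lemma abs_re_lt_of_mem_image {z : ℂ} (hz : z ∈ scMap '' Metric.ball 0 1) : |z.re| < K := by
  rw [← image_hexagon] at hz
  obtain ⟨y, hy, rfl⟩ := hz
  have h1 := re_lt_of_mem_hexagon hy (u := 1) (by norm_num)
  have h2 := re_lt_of_mem_hexagon hy (u := -1) (by norm_num)
  rw [one_mul] at h1
  rw [neg_one_mul, neg_re] at h2
  exact abs_lt.2 ⟨by linarith, h1⟩

/-! ### Continuation of the inverse to the row of hexagons. -/

/-- The index of the strip `(2 n - 1) K < re z ≤ (2 n + 1) K` that contains `z`. -/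
noncomputable def stripIndex (z : ℂ) : ℤ := ⌈(z.re - K) / (2 * K)⌉

/-- The inverse of the Schwarz-Christoffel map, continued to the row of hexagons. -/
noncomputable def hexTan (z : ℂ) : ℂ :=
  if Even (stripIndex z) then
    Function.invFunOn scMap (Metric.closedBall 0 1) (z - 2 * stripIndex z * K)
  else -(Function.invFunOn scMap (Metric.closedBall 0 1) (z - 2 * stripIndex z * K))⁻¹

lemma stripIndex_add (z : ℂ) (n : ℤ) : stripIndex (z + 2 * n * K) = stripIndex z + n := by
  have e : ((z + 2 * n * K : ℂ).re - K) / (2 * K) = (z.re - K) / (2 * K) + n := by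
    have h : (z + 2 * n * K : ℂ).re = z.re + 2 * n * K := by
      have : (2 * n * K : ℂ) = (2 * n * K : ℝ) := by push_cast; ring
      rw [this, add_re, ofReal_re]
    have := K_pos.ne'
    rw [h]; field_simp; ring
  rw [stripIndex, e, Int.ceil_add_intCast, stripIndex]

lemma hexTan_add_even (z : ℂ) {n : ℤ} (hn : Even n) : hexTan (z + 2 * n * K) = hexTan z := by
  have e : z + 2 * n * K - 2 * ((stripIndex z + n : ℤ) : ℂ) * K = z - 2 * stripIndex z * K := by
    push_cast; ring
  rw [hexTan, stripIndex_add, e, hexTan]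
  simp only [Int.even_add, hn, iff_true]

/-- Valid at every `z`, poles included, since `0⁻¹ = 0` makes `x ↦ -x⁻¹` an involution. -/
lemma hexTan_add_odd (z : ℂ) {n : ℤ} (hn : ¬Even n) :
    hexTan (z + 2 * n * K) = -(hexTan z)⁻¹ := by
  have e : z + 2 * n * K - 2 * ((stripIndex z + n : ℤ) : ℂ) * K = z - 2 * stripIndex z * K := by
    push_cast; ring
  rw [hexTan, stripIndex_add, e, hexTan]
  by_cases h : Even (stripIndex z) <;> simp [Int.even_add, hn, h]

lemma hexTan_scMap_of_re {w : ℂ} (hw : w ∈ Metric.closedBall (0 : ℂ) 1)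
    (h1 : -K < (scMap w).re) (h2 : (scMap w).re ≤ K) : hexTan (scMap w) = w := by
  have hi : stripIndex (scMap w) = 0 := by
    have hK := K_pos
    rw [stripIndex, Int.ceil_eq_iff]
    constructor
    · rw [lt_div_iff₀ (by positivity)]; push_cast; linarith
    · rw [div_le_iff₀ (by positivity)]; push_cast; linarith
  rw [hexTan, hi]
  simp only [Even.zero, if_true, Int.cast_zero, mul_zero, zero_mul, sub_zero]
  exact injOn_scMap.leftInvOn_invFunOn hw

lemma hexTan_scMap {w : ℂ} (hw : w ∈ Metric.ball (0 : ℂ) 1) : hexTan (scMap w) = w := by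
  have := abs_lt.1 (abs_re_lt_of_mem_image (mem_image_of_mem scMap hw))
  exact hexTan_scMap_of_re (Metric.ball_subset_closedBall hw) this.1 this.2.le

lemma norm_exp_lt_one {ζ : ℂ} (h : ζ.re < 0) : exp ζ ∈ Metric.ball (0 : ℂ) 1 := by
  rw [mem_ball_zero_iff, norm_exp]; exact Real.exp_zero ▸ Real.exp_lt_exp.2 h

/-- This shows that the definitions on adjacent hexagons fit together across the edge. For `ζ.re >
0` reflection and oddness put the point in the next hexagon; for `ζ.re = 0` it lies on the edge,
which the ceiling in `stripIndex` assigns to the hexagon on its left. -/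
lemma hexTan_scMap_exp {ζ : ℂ} (h : ζ ∈ strip) : hexTan (scMap (exp ζ)) = exp ζ := by
  rcases lt_trichotomy ζ.re 0 with h0 | h0 | h0
  · exact hexTan_scMap (norm_exp_lt_one h0)
  · have e : ζ = ζ.im * I := by apply Complex.ext <;> simp [h0]
    have hre : (scMap (exp ζ)).re = K := by rw [e]; exact re_scMap_circle (le_of_lt h)
    refine hexTan_scMap_of_re ?_ ?_ hre.le
    · rw [mem_closedBall_zero_iff, norm_exp, h0, Real.exp_zero]
    · rw [hre]; have := K_pos; linarith
  · have hb : exp (-ζ) ∈ Metric.ball (0 : ℂ) 1 := norm_exp_lt_one (by simpa using h0)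
    have hb' : -exp (-ζ) ∈ Metric.ball (0 : ℂ) 1 := by simpa using hb
    have hneg : scMap (-exp (-ζ)) = -scMap (exp (-ζ)) := by
      simpa using scMap_mul (u := -1) (by norm_num) (exp (-ζ))
    have e : scMap (exp ζ) = scMap (-exp (-ζ)) + 2 * (1 : ℤ) * K := by
      have := scMap_exp_add_scMap_exp_neg h
      rw [hneg]; push_cast; linear_combination this
    rw [e, hexTan_add_odd _ (by decide), hexTan_scMap hb', inv_neg, neg_neg, Complex.exp_neg,
      inv_inv]

lemma deriv_scMap_ne_zero {w : ℂ} (hw : w ∈ slitDomain) : deriv scMap w ≠ 0 := by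
  rw [(hasDerivAt_scMap hw).deriv]; exact density_ne_zero hw

lemma ball_subset_slitDomain {w : ℂ} (hw : w ∈ Metric.ball (0 : ℂ) 1) : w ∈ slitDomain :=
  mem_slitDomain_of_norm_lt_one (mem_ball_zero_iff.1 hw)

lemma hexTan_comp_scMap_eventuallyEq {w : ℂ} (hw : w ∈ Metric.ball (0 : ℂ) 1) :
    hexTan ∘ scMap =ᶠ[𝓝 w] id := by
  filter_upwards [Metric.isOpen_ball.mem_nhds hw] with v hv
  exact hexTan_scMap hv

lemma analyticAt_hexTan_scMap {w : ℂ} (hw : w ∈ Metric.ball (0 : ℂ) 1) :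
    AnalyticAt ℂ hexTan (scMap w) := by
  have hd := ball_subset_slitDomain hw
  rw [← analyticAt_comp_iff_of_deriv_ne_zero (analyticAt_scMap hd) (deriv_scMap_ne_zero hd)]
  exact analyticAt_id.congr (hexTan_comp_scMap_eventuallyEq hw).symm

/-- `scMap ∘ exp` is a local biholomorphism, and composing `hexTan` with it gives `exp`. -/
lemma analyticAt_hexTan_scMap_exp {ζ : ℂ} (h : ζ ∈ strip) :
    AnalyticAt ℂ hexTan (scMap (exp ζ)) := by
  have hd := exp_mem_slitDomain h
  have hder : deriv (scMap ∘ exp) ζ ≠ 0 := by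
    rw [((hasDerivAt_scMap hd).comp ζ (Complex.hasDerivAt_exp ζ)).deriv]
    exact mul_ne_zero (density_ne_zero hd) (Complex.exp_ne_zero ζ)
  have ha : AnalyticAt ℂ (scMap ∘ exp) ζ := (analyticAt_scMap hd).comp analyticAt_cexp
  refine (analyticAt_comp_iff_of_deriv_ne_zero ha hder).1 (analyticAt_cexp.congr ?_)
  filter_upwards [isOpen_strip.mem_nhds h] with η hη
  exact (hexTan_scMap_exp hη).symm

lemma analyticAt_hexTan_add {z : ℂ} (hz : AnalyticAt ℂ hexTan z) {n : ℤ}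
    (hn : Even n ∨ hexTan z ≠ 0) : AnalyticAt ℂ hexTan (z + 2 * n * K) := by
  have hcomp : AnalyticAt ℂ (fun w => hexTan (w - 2 * n * K)) (z + 2 * n * K) := by
    refine AnalyticAt.comp (g := hexTan) (f := fun w => w - 2 * n * K) ?_ (by fun_prop)
    simpa using hz
  by_cases he : Even n
  · refine hcomp.congr (Eventually.of_forall fun w => ?_)
    simp only
    rw [← hexTan_add_even (w - 2 * n * K) he, sub_add_cancel]
  · have h0 := hn.resolve_left he
    refine (hcomp.inv (by simpa using h0)).neg.congr (Eventually.of_forall fun w => ?_)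
    simp only [Pi.neg_apply, Pi.inv_apply]
    rw [← hexTan_add_odd (w - 2 * n * K) he, sub_add_cancel]

lemma hexTan_zero : hexTan 0 = 0 := by
  simpa [scMap_zero] using hexTan_scMap (Metric.mem_ball_self (x := (0 : ℂ)) one_pos)

lemma meromorphicOrderAt_hexTan_zero : meromorphicOrderAt hexTan 0 = 1 := by
  have h0 := Metric.mem_ball_self (x := (0 : ℂ)) one_pos
  have hd := ball_subset_slitDomain h0
  have h := meromorphicOrderAt_comp_of_deriv_ne_zero (f := hexTan) (analyticAt_scMap hd)
    (deriv_scMap_ne_zero hd)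
  rw [scMap_zero] at h
  rw [← h, meromorphicOrderAt_congr
    ((hexTan_comp_scMap_eventuallyEq h0).filter_mono nhdsWithin_le_nhds), meromorphicOrderAt_id]

/-- Translation turns `hexTan` into its negated inverse, which flips the order `1` at the origin. -/
lemma meromorphicOrderAt_hexTan_odd {n : ℤ} (hn : ¬Even n) :
    meromorphicOrderAt hexTan (2 * n * K) = -1 := by
  have h := meromorphicOrderAt_comp_add_const_eq_meromorphicOrderAt (f := hexTan) (x := (0 : ℂ))
    (c := 2 * n * K)
  have e : hexTan ∘ (· + (2 * n * K : ℂ)) = -(hexTan⁻¹) := by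
    ext z; exact hexTan_add_odd z hn
  rw [zero_add, e, ← meromorphicOrderAt_neg, meromorphicOrderAt_inv,
    meromorphicOrderAt_hexTan_zero] at h
  exact h.symm

lemma hexagonAt_eq (n : ℤ) :
    hexagonAt n = (fun z => z + 2 * (n : ℂ) * K) '' (scMap '' Metric.ball 0 1) := by
  rw [← image_hexagon, image_image, hexagonAt]
  simp only [add_comm]

lemma exists_of_mem_sharedEdge {n : ℤ} {z : ℂ} (hz : z ∈ sharedEdge n) :
    ∃ ζ ∈ strip, z = scMap (exp ζ) + 2 * n * K := by
  have hpi := Real.pi_pos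
  have hL := L_pos
  obtain ⟨a, b, ha, hb, hab, rfl⟩ := hz
  have hδ : exp ((-(Real.pi / 6) : ℝ) * I) = conj δ := by
    rw [delta_eq, ← exp_conj, map_mul, conj_ofReal, conj_I]; simp
  have hδ6 : conj δ = conj δ ^ 2 * δ := by
    rw [conj_delta]; have := delta_ne_zero; field_simp
  have hconj : scMap (conj δ) = conj δ * L := by
    have h6 : (conj δ ^ 2) ^ 6 = 1 := by
      rw [← pow_mul, mul_comm, pow_mul, ← map_pow, delta_pow_six]; simp
    have := scMap_mul h6 δ
    rw [← hδ6, scMap_delta, ← mul_assoc, ← hδ6] at this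
    exact this
  set f : ℝ → ℝ := fun θ => (scMap (exp (θ * I))).im with hf
  have hf1 : f (-(Real.pi / 6)) = -(L / 2) := by
    simp only [hf]; rw [hδ, hconj, im_mul_ofReal, conj_im, delta_im]; ring
  have hf2 : f (Real.pi / 6) = L / 2 := by
    simp only [hf]; rw [← delta_eq, scMap_delta, im_mul_ofReal, delta_im]; ring
  -- The arc maps into the line of the edge, and its ends map to the vertices; the intermediate
  -- value theorem for the imaginary part reaches every point between.
  obtain ⟨θ, hθ, hθ'⟩ := intermediate_value_Ioo (show -(Real.pi / 6) ≤ Real.pi / 6 by linarith)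
    (continuous_im.comp continuous_scMap_circle).continuousOn
    (show (a - b) * (L / 2) ∈ Ioo (f (-(Real.pi / 6))) (f (Real.pi / 6)) by
      rw [hf1, hf2]; constructor <;> nlinarith)
  refine ⟨θ * I, by simpa [strip, abs_lt] using hθ, ?_⟩
  have hθ2 : scMap (exp (θ * I)) = K + ((a - b) * (L / 2) : ℝ) * I := by
    apply Complex.ext
    · rw [re_scMap_circle (abs_lt.2 hθ).le]; simp
    · simp only [Function.comp] at hθ'
      rw [hθ']; simp
  have hδK : δ = (Real.sqrt 3 / 2 : ℝ) + (1 / 2 : ℝ) * I := by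
    apply Complex.ext <;> simp [delta_re, delta_im]
  have hb' : b = 1 - a := by linarith
  rw [hθ2, K_eq, hδK, hb']
  simp only [real_smul, map_add, map_mul, conj_ofReal, conj_I]
  push_cast
  ring

lemma ofReal_mem_band (x : ℝ) : (x : ℂ) ∈ band := by
  have hK := K_pos
  set n := stripIndex x with hn
  have h1 : (n : ℝ) < (x - K) / (2 * K) + 1 := Int.ceil_lt_add_one _
  have h2 : (x - K) / (2 * K) ≤ n := Int.le_ceil _
  rw [div_le_iff₀ (by positivity)] at h2
  have h1' : ((n : ℝ) - 1) * (2 * K) < x - K := by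
    rw [← lt_div_iff₀ (by positivity)]; linarith
  rcases h2.lt_or_eq with h3 | h3
  · refine Or.inl (mem_iUnion.2 ⟨n, ?_⟩)
    rw [hexagonAt_eq]
    refine ⟨(x - 2 * n * K : ℝ), ball_subset_image_scMap ?_, by push_cast; ring⟩
    rw [mem_ball_zero_iff, norm_real, Real.norm_eq_abs, abs_lt]
    constructor <;> linarith
  -- Here `x = (2 * n + 1) * K` is the midpoint of a shared edge.
  · refine Or.inr (mem_iUnion.2 ⟨n, 1 / 2, 1 / 2, by norm_num, by norm_num, by norm_num, ?_⟩)
    have hx : x = 2 * n * K + K := by linarith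
    have hδ : δ + conj δ = (Real.sqrt 3 : ℝ) := by rw [add_conj, delta_re]; push_cast; ring
    have hK' : (K : ℂ) = (Real.sqrt 3 : ℝ) / 2 * L := by rw [K_eq]; push_cast; ring
    simp only [real_smul]
    rw [hx]
    push_cast
    linear_combination (L / 2 : ℂ) * hδ - hK'

lemma band_add {z : ℂ} (hz : z ∈ band) (n : ℤ) : z + 2 * n * K ∈ band := by
  rcases hz with hz | hz
  · obtain ⟨m, hm⟩ := mem_iUnion.1 hz
    refine Or.inl (mem_iUnion.2 ⟨m + n, ?_⟩)
    obtain ⟨y, hy, rfl⟩ := hm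
    exact ⟨y, hy, by push_cast; ring⟩
  · obtain ⟨m, a, b, ha, hb, hab, rfl⟩ := mem_iUnion.1 hz
    refine Or.inr (mem_iUnion.2 ⟨m + n, a, b, ha, hb, hab, ?_⟩)
    have hb' : (b : ℂ) = 1 - a := by
      have : b = 1 - a := by linarith
      rw [this]; push_cast; ring
    simp only [real_smul]
    push_cast
    linear_combination (2 * n * K : ℂ) * hb'

lemma analyticAt_hexTan_band {z : ℂ} (hz : z ∈ band) (ho : z ∉ oddPoints) :
    AnalyticAt ℂ hexTan z := by
  rcases hz with hz | hz
  · obtain ⟨n, hn⟩ := mem_iUnion.1 hz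
    rw [hexagonAt_eq] at hn
    obtain ⟨_, ⟨w, hw, rfl⟩, rfl⟩ := hn
    refine analyticAt_hexTan_add (analyticAt_hexTan_scMap hw) ?_
    -- An odd translate fails to be analytic only over a zero of `hexTan`, that is `w = 0`, which
    -- gives a point of `oddPoints`.
    by_contra! hcon
    obtain ⟨k, rfl⟩ := Int.not_even_iff_odd.1 hcon.1
    rw [hexTan_scMap hw] at hcon
    refine ho ⟨k, ?_⟩
    simp only [hcon.2, scMap_zero]
    push_cast; ring
  · obtain ⟨n, hn⟩ := mem_iUnion.1 hz
    obtain ⟨ζ, hζ, rfl⟩ := exists_of_mem_sharedEdge hn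
    refine analyticAt_hexTan_add (analyticAt_hexTan_scMap_exp hζ) (Or.inr ?_)
    rw [hexTan_scMap_exp hζ]
    exact Complex.exp_ne_zero ζ

lemma oddPoint_mem_band {z : ℂ} (hz : z ∈ oddPoints) :
    z ∈ band ∧ meromorphicOrderAt hexTan z = -1 := by
  obtain ⟨k, rfl⟩ := hz
  have e : (2 * (k : ℂ) + 1) * (2 * K) = 2 * ((2 * k + 1 : ℤ) : ℂ) * K := by push_cast; ring
  rw [e]
  refine ⟨?_, meromorphicOrderAt_hexTan_odd (by simp)⟩
  simpa using band_add (ofReal_mem_band 0) (2 * k + 1)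

lemma meromorphicOn_hexTan : MeromorphicOn hexTan band := by
  intro z hz
  by_cases h : z ∈ oddPoints
  · refine meromorphicAt_of_meromorphicOrderAt_ne_zero ?_
    rw [(oddPoint_mem_band h).2]; decide
  · exact (analyticAt_hexTan_band hz h).meromorphicAt

/-! ### The least positive real period. -/

lemma scMap_hexTan_ofReal {x : ℝ} (h1 : -K < x) (h2 : x ≤ K) : scMap (hexTan x) = x := by
  rcases h2.lt_or_eq with h | h
  · obtain ⟨w, hw, he⟩ := ball_subset_image_scMap (show (x : ℂ) ∈ Metric.ball 0 K by
      rw [mem_ball_zero_iff, norm_real, Real.norm_eq_abs, abs_lt]; exact ⟨h1, h⟩)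
    rw [← he, hexTan_scMap hw]
  · have h0 : (0 : ℂ) ∈ strip := by simp [strip, Real.pi_pos]
    have := hexTan_scMap_exp h0
    rw [Complex.exp_zero, scMap_one] at this
    rw [h, this, scMap_one]

lemma hexTan_K : hexTan K = 1 := by
  have h0 : (0 : ℂ) ∈ strip := by simp [strip, Real.pi_pos]
  simpa [scMap_one] using hexTan_scMap_exp h0

lemma hexTan_add_period (z : ℂ) : hexTan (z + (4 * K : ℝ)) = hexTan z := by
  rw [← hexTan_add_even z (n := 2) (by decide)]
  congr 1
  push_cast; ring

/-- The value `1` at `K` is not repeated before `5 * K`. Moving `K + a` back into `(-K, K]` by `2 *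
K` or `4 * K` makes the value there `-1` or `1`, and applying `scMap` forces `a = 0` or `a = 4 * K`.
-/
lemma four_K_le_of_period {a : ℝ} (ha : 0 < a) (h : hexTan (K + a) = hexTan K) : 4 * K ≤ a := by
  by_contra! hlt
  have hK := K_pos
  rw [hexTan_K] at h
  rcases le_or_gt a (2 * K) with h2 | h2
  · have e : (K + a : ℂ) = ((a - K : ℝ) : ℂ) + 2 * (1 : ℤ) * K := by push_cast; ring
    rw [e, hexTan_add_odd _ (by decide)] at h
    have h3 : hexTan ((a - K : ℝ) : ℂ) = -1 := by
      rw [neg_eq_iff_eq_neg] at h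
      rw [← inv_inv (hexTan _), h]; norm_num
    have h4 := scMap_hexTan_ofReal (x := a - K) (by linarith) (by linarith)
    have h5 : scMap (-1) = -(K : ℂ) := by
      simpa [scMap_one] using scMap_mul (u := -1) (by norm_num) 1
    rw [h3, h5] at h4
    have : -K = a - K := by exact_mod_cast h4
    linarith
  · have e : (K + a : ℂ) = ((a - 3 * K : ℝ) : ℂ) + 2 * (2 : ℤ) * K := by push_cast; ring
    rw [e, hexTan_add_even _ (by decide)] at h
    have h4 := scMap_hexTan_ofReal (x := a - 3 * K) (by linarith) (by linarith)
    rw [h, scMap_one] at h4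
    have : K = a - 3 * K := by exact_mod_cast h4
    linarith

/-! ### The solution pair and its uniqueness. -/

lemma r_lt_K : r < K := by
  have := half_le_K
  have : r < 1 / 2 := by norm_num [r]
  linarith

lemma exists_scMap_of_mem_ball {z : ℂ} (hz : z ∈ Metric.ball (0 : ℂ) r) :
    ∃ w ∈ Metric.ball (0 : ℂ) 1, scMap w = z :=
  ball_subset_image_scMap (Metric.ball_subset_ball r_lt_K.le hz)

lemma hasDerivAt_hexTan {w : ℂ} (hw : w ∈ Metric.ball (0 : ℂ) 1) :
    HasDerivAt hexTan (density w)⁻¹ (scMap w) := by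
  have hd := ball_subset_slitDomain hw
  have h1 := (analyticAt_hexTan_scMap hw).differentiableAt.hasDerivAt
  have h2 := (h1.comp w (hasDerivAt_scMap hd)).congr_of_eventuallyEq
    (hexTan_comp_scMap_eventuallyEq hw).symm
  have h3 := h2.unique (hasDerivAt_id w)
  rwa [eq_inv_of_mul_eq_one_left h3] at h1

/-- The function `c` of the solution pair. -/
noncomputable def hexCos (z : ℂ) : ℂ := (1 + hexTan z ^ 6) ^ (-(1 / 6) : ℂ)

lemma hexCos_scMap_ne_zero {w : ℂ} (hw : w ∈ Metric.ball (0 : ℂ) 1) : hexCos (scMap w) ≠ 0 := by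
  rw [hexCos, hexTan_scMap hw, Ne, cpow_eq_zero_iff]
  exact fun h => slitPlane_ne_zero (ball_subset_slitDomain hw) h.1

/-- With `t = hexTan` and `c = hexCos`, `c ^ 6 * (1 + t ^ 6) = 1` gives `t' = c⁻¹ ^ 2`. Then `(t *
c)' = c⁻¹ - t ^ 6 * c ^ 5 = c ^ 5`. -/
lemma hasDerivAt_hexCos {w : ℂ} (hw : w ∈ Metric.ball (0 : ℂ) 1) :
    HasDerivAt hexCos (-((hexTan (scMap w) * hexCos (scMap w)) ^ 5)) (scMap w) ∧
    HasDerivAt (fun z => hexTan z * hexCos z) (hexCos (scMap w) ^ 5) (scMap w) := by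
  have hd : 1 + w ^ 6 ∈ slitPlane := ball_subset_slitDomain hw
  have hne : 1 + w ^ 6 ≠ 0 := slitPlane_ne_zero hd
  have hT := hasDerivAt_hexTan hw
  have hTw := hexTan_scMap hw
  have hp0 := hexCos_scMap_ne_zero hw
  have hpdef : hexCos (scMap w) = (1 + w ^ 6) ^ (-(1 / 6) : ℂ) := by rw [hexCos, hTw]
  set p := hexCos (scMap w) with hp
  have hp6 : p ^ 6 * (1 + w ^ 6) = 1 := by
    rw [hpdef, ← cpow_nat_mul, show ((6 : ℕ) : ℂ) * -(1 / 6) = -1 by push_cast; ring, cpow_neg_one,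
      inv_mul_cancel₀ hne]
  have hp2 : density w = p ^ 2 := by
    rw [density, hpdef, ← cpow_nat_mul]; congr 1; push_cast; ring
  have hp7 : (1 + w ^ 6) ^ (-(1 / 6) - 1 : ℂ) = p ^ 7 := by
    rw [hpdef, ← cpow_nat_mul]; congr 1; push_cast; ring
  have h1 : HasDerivAt (fun z => 1 + hexTan z ^ 6) (6 * w ^ 5 * (density w)⁻¹) (scMap w) := by
    have := (hT.pow 6).const_add 1
    rw [hTw] at this
    simpa using this
  have h2 : HasDerivAt hexCos (-((w * p) ^ 5)) (scMap w) := by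
    have h3 := h1.cpow_const (c := (-(1 / 6) : ℂ)) (by rw [hTw]; exact hd)
    rw [hTw, hp7, hp2] at h3
    refine h3.congr_deriv ?_
    field_simp
  refine ⟨by rwa [hTw], ?_⟩
  have h4 := hT.mul h2
  rw [hTw, hp2, ← hp] at h4
  refine h4.congr_deriv ?_
  field_simp
  linear_combination -hp6

lemma isSolutionPair_hex : IsSolutionPair (fun z => hexTan z * hexCos z) hexCos where
  deriv_s z hz := by
    obtain ⟨w, hw, rfl⟩ := exists_scMap_of_mem_ball hz
    exact (hasDerivAt_hexCos hw).2
  deriv_c z hz := by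
    obtain ⟨w, hw, rfl⟩ := exists_scMap_of_mem_ball hz
    exact (hasDerivAt_hexCos hw).1
  s_zero := by simp [hexTan_zero]
  c_zero := by simp [hexCos, hexTan_zero]

/-- On the segment from `0` to `z` both pairs solve one polynomial real-time system and stay in a
common ball, where the field is Lipschitz. -/
lemma IsSolutionPair.eqOn {s c s' c' : ℂ → ℂ} (h : IsSolutionPair s c) (h' : IsSolutionPair s' c')
    {z : ℂ} (hz : z ∈ Metric.ball (0 : ℂ) r) : s z = s' z ∧ c z = c' z := by
  have hmem : ∀ x ∈ Icc (0 : ℝ) 1, (x : ℂ) * z ∈ Metric.ball (0 : ℂ) r := by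
    intro x hx
    rw [mem_ball_zero_iff] at hz ⊢
    rw [norm_mul, norm_real, Real.norm_of_nonneg hx.1]
    nlinarith [norm_nonneg z, hx.2]
  let v : ℂ × ℂ → ℂ × ℂ := fun p => (z * p.2 ^ 5, z * -(p.1 ^ 5))
  have hpath : ∀ {s c : ℂ → ℂ}, IsSolutionPair s c → ∀ x ∈ Icc (0 : ℝ) 1,
      HasDerivAt (fun x : ℝ => (s (x * z), c (x * z))) (v (s (x * z), c (x * z))) x := by
    intro s c h x hx
    have h1 : HasDerivAt (fun y : ℂ => y * z) z x := by
      simpa using (hasDerivAt_id (x : ℂ)).mul_const z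
    have h2 := ((h.deriv_s _ (hmem x hx)).comp (x : ℂ) h1).comp_ofReal
    have h3 := ((h.deriv_c _ (hmem x hx)).comp (x : ℂ) h1).comp_ofReal
    rw [mul_comm] at h2 h3
    exact h2.prodMk h3
  have hcont : ∀ {s c : ℂ → ℂ}, IsSolutionPair s c →
      ContinuousOn (fun x : ℝ => (s (x * z), c (x * z))) (Icc 0 1) := fun h x hx =>
    (hpath h x hx).continuousAt.continuousWithinAt
  obtain ⟨A, hA⟩ := isCompact_Icc.exists_bound_of_continuousOn (hcont h)
  obtain ⟨B, hB⟩ := isCompact_Icc.exists_bound_of_continuousOn (hcont h')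
  have hv : ContDiff ℂ 1 v := by fun_prop
  obtain ⟨M, hM⟩ := hv.locallyLipschitz.locallyLipschitzOn.exists_lipschitzOnWith_of_compact
    (isCompact_closedBall (0 : ℂ × ℂ) (max A B))
  have := ODE_solution_unique_of_mem_Icc_right (v := fun _ => v) (K := M)
    (s := fun _ => Metric.closedBall (0 : ℂ × ℂ) (max A B)) (fun _ _ => hM) (hcont h)
    (fun x hx => (hpath h x (Ico_subset_Icc_self hx)).hasDerivWithinAt)
    (fun x hx => mem_closedBall_zero_iff.2
      ((hA x (Ico_subset_Icc_self hx)).trans (le_max_left _ _)))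
    (hcont h') (fun x hx => (hpath h' x (Ico_subset_Icc_self hx)).hasDerivWithinAt)
    (fun x hx => mem_closedBall_zero_iff.2
      ((hB x (Ico_subset_Icc_self hx)).trans (le_max_right _ _)))
    (by simp [h.s_zero, h.c_zero, h'.s_zero, h'.c_zero]) (right_mem_Icc.2 zero_le_one)
  simpa using this

lemma ball_subset_band : Metric.ball (0 : ℂ) r ⊆ band := by
  intro z hz
  obtain ⟨w, hw, rfl⟩ := exists_scMap_of_mem_ball hz
  refine Or.inl (mem_iUnion.2 ⟨0, ?_⟩)
  rw [hexagonAt_eq]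
  exact ⟨_, ⟨w, hw, rfl⟩, by simp⟩

end HexBand

theorem theorem9 :
    HexBand.K = Real.sqrt 3 / 2 * HexBand.L ∧
    (∃ s c : ℂ → ℂ, HexBand.IsSolutionPair s c) ∧
    ∀ s c : ℂ → ℂ, HexBand.IsSolutionPair s c →
      ∃ t : ℂ → ℂ,
        -- `t` is meromorphic in the band and extends `s / c`
        MeromorphicOn t HexBand.band ∧
        (∀ z ∈ Metric.ball (0 : ℂ) HexBand.r,
          z ∈ HexBand.band ∧ c z ≠ 0 ∧ t z = s z / c z) ∧
        -- `4 K` is a period, and the least positive real one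
        0 < 4 * HexBand.K ∧
        (∀ z ∈ HexBand.band, z + ((4 * HexBand.K : ℝ) : ℂ) ∈ HexBand.band ∧
          t (z + ((4 * HexBand.K : ℝ) : ℂ)) = t z) ∧
        (∀ a : ℝ, 0 < a →
          (∀ z ∈ HexBand.band, z + (a : ℂ) ∈ HexBand.band → t (z + (a : ℂ)) = t z) →
          4 * HexBand.K ≤ a) ∧
        -- holomorphic except for simple poles at the odd multiples of `2 K`
        (∀ z ∈ HexBand.band, z ∉ HexBand.oddPoints → AnalyticAt ℂ t z) ∧
        (∀ z ∈ HexBand.oddPoints, z ∈ HexBand.band ∧ meromorphicOrderAt t z = -1) := by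
  open HexBand in
  refine ⟨K_eq, ⟨_, _, isSolutionPair_hex⟩, fun s c hsc => ⟨hexTan, meromorphicOn_hexTan,
    fun z hz => ?_, by have := K_pos; positivity, fun z hz => ⟨?_, hexTan_add_period z⟩,
    fun a ha h => ?_, fun z => analyticAt_hexTan_band, fun z => oddPoint_mem_band⟩⟩
  · obtain ⟨hs, hc⟩ := hsc.eqOn isSolutionPair_hex hz
    have hc0 : hexCos z ≠ 0 := by
      obtain ⟨w, hw, rfl⟩ := exists_scMap_of_mem_ball hz
      exact hexCos_scMap_ne_zero hw
    refine ⟨ball_subset_band hz, hc ▸ hc0, ?_⟩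
    rw [hs, hc, mul_div_cancel_right₀ _ hc0]
  · have e : ((4 * K : ℝ) : ℂ) = 2 * ((2 : ℤ) : ℂ) * K := by push_cast; ring
    rw [e]
    exact band_add hz 2
  -- Testing at `K` suffices, since the whole real line lies in the band.
  · refine four_K_le_of_period ha (h K (ofReal_mem_band K) ?_)
    rw [← Complex.ofReal_add]
    exact ofReal_mem_band _
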